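/- Let $d\ge 0$, $n=(n_1,\dots,n_d)\in\mathbb N_0^d$, $|n|=n_1+\dots+n_d$, and for $z\in\mathbb C^d$ let $Z_n=\bigoplus_{i=1}^d z_iI_{n_i}$. Let $K$ be a complex $|n|\times|n|$ matrix with $\|K\|\le 1$ (operator norm), and let $p\in\mathbb C[z_1,\dots,z_d]$ be the polynomial $p(z)=\det(I-KZ_n)$. Write $\bar p(z)=\overline{p(\bar z)}$, $\mathbb D^d=\{z\in\mathbb C^d:|z_i|<1 \text{ for all } i\}$, and $\deg p=(\deg_1p,\dots,\deg_dp)$, where $\deg_i p$ is the degree of $p$ in $z_i$. The polynomial $p$ is semi-stable if it has no zeros in $\mathbb D^d$. The (scalar) Schur--Agler class consists of the analytic functions $f(z)=\sum_k c_kz^k$ on $\mathbb D^d$ with $\|f(T)\|\le 1$, $f(T)=\sum_kc_kT^k$, for all $d$-tuples $T$ of commuting strict contractions on a common complex Hilbert space. For $m\in\mathbb N_0^d$, a semi-stable polynomial $p$ is an eventual Agler denominator of order $m$ if $\deg p\le m$ componentwise and $z^m\bar p(1/z)/p(z)$ is in the Schur--Agler class; it is an Agler denominator if this holds with $m=\deg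 p$. Then $\deg p\le n$, so that $z^n\bar p(1/z)$ is a polynomial, and $$\frac{z^n\bar p(1/z)}{p(z)}=\det\left(-K^*+\sqrt{I-K^*K}\,Z_n(I-KZ_n)^{-1}\sqrt{I-KK^*}\right)$$ for all $z\in\mathbb C^d$ with $p(z)\ne 0$. The function $z^n\bar p(1/z)/p(z)$ is rational inner on $\mathbb D^d$ (analytic and bounded by $1$ there, with radial limits that exist and are unimodular almost everywhere on the $d$-torus), and $p$ is an eventual Agler denominator of order $n$; in particular this rational inner function lies in the Schur--Agler class. If $\deg p=n$, then $p$ is an Agler denominator. -/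

import Mathlib

open scoped MatrixOrder

universe u

/-- The open unit polydisk in `ℂ^d`. -/
def polydisk (d : ℕ) : Set (Fin d → ℂ) := {z | ∀ i, ‖z i‖ < 1}

/-- The diagonal matrix `Z_n = ⨁ᵢ zᵢ I_{nᵢ}` over a commutative ring; its rows and columns are
indexed by the `|n| = n₁ + ⋯ + n_d` pairs `(i, j)` with `j < nᵢ`. -/
def blockDiag {d : ℕ} {R : Type*} [CommRing R] (n : Fin d → ℕ) (z : Fin d → R) :
    Matrix (Σ i, Fin (n i)) (Σ i, Fin (n i)) R :=
  Matrix.diagonal fun a => z a.1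

/-- The polynomial `det (I - K Z_n)` in `ℂ[z₁, …, z_d]`. -/
noncomputable def detRep {d : ℕ} (n : Fin d → ℕ)
    (K : Matrix (Σ i, Fin (n i)) (Σ i, Fin (n i)) ℂ) : MvPolynomial (Fin d) ℂ :=
  (1 - K.map MvPolynomial.C * blockDiag n MvPolynomial.X).det

/-- A complex square matrix is a contraction if its operator norm with respect to the Euclidean
norm is at most one. -/
def IsContraction {ι : Type*} [Fintype ι] [DecidableEq ι] (K : Matrix ι ι ℂ) : Prop :=
  ‖Matrix.toEuclideanCLM (𝕜 := ℂ) K‖ ≤ 1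

/-- The matrix `-K* + √(I - K*K) Z_n (I - K Z_n)⁻¹ √(I - KK*)`, with positive semidefinite
square roots. -/
noncomputable def transferMatrix {d : ℕ} (n : Fin d → ℕ)
    (K : Matrix (Σ i, Fin (n i)) (Σ i, Fin (n i)) ℂ) (z : Fin d → ℂ) :
    Matrix (Σ i, Fin (n i)) (Σ i, Fin (n i)) ℂ :=
  -K.conjTranspose + CFC.sqrt (1 - K.conjTranspose * K) * blockDiag n z *
    (1 - K * blockDiag n z)⁻¹ * CFC.sqrt (1 - K * K.conjTranspose)

/-- The multi-degree of a polynomial. -/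
noncomputable def multiDegree {d : ℕ} (p : MvPolynomial (Fin d) ℂ) : Fin d → ℕ :=
  fun i => p.degreeOf i

/-- The polynomial `z^n p̄(1/z) = ∑ₖ conj(pₖ) z^(n-k)`, where `p̄(z) = conj (p (conj z))`. It is
meant for `multiDegree p ≤ n`, see `eval_reflection`. -/
noncomputable def reflection {d : ℕ} (n : Fin d → ℕ) (p : MvPolynomial (Fin d) ℂ) :
    MvPolynomial (Fin d) ℂ :=
  ∑ k ∈ p.support, MvPolynomial.C (star (p.coeff k)) * ∏ i, MvPolynomial.X i ^ (n i - k i)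

theorem eval_reflection {d : ℕ} (n : Fin d → ℕ) (p : MvPolynomial (Fin d) ℂ)
    (hp : multiDegree p ≤ n) (z : Fin d → ℂ) (hz : ∀ i, z i ≠ 0) :
    MvPolynomial.eval z (reflection n p) =
      (∏ i, z i ^ n i) * star (MvPolynomial.eval (fun i => star (1 / z i)) p) := by
  rw [MvPolynomial.eval_eq' (fun i => star (1 / z i)) p, star_sum, Finset.mul_sum, reflection, map_sum]
  refine Finset.sum_congr rfl fun k hk => ?_
  have hkn : ∀ i, k i ≤ n i := fun i => (MvPolynomial.monomial_le_degreeOf i hk).trans (hp i)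
  have h : ∀ i, z i ^ (n i - k i) = z i ^ n i * (1 / z i) ^ k i := fun i => by
    rw [pow_sub₀ _ (hz i) (hkn i), one_div, inv_pow]
  simp only [map_mul, MvPolynomial.eval_C, map_prod, map_pow, MvPolynomial.eval_X, h,
    Finset.prod_mul_distrib, star_mul', star_prod, star_pow, star_star]
  ring

/-- The function `z ↦ z^n p̄(1/z) / p(z)`. -/
noncomputable def reflectionQuotient {d : ℕ} (n : Fin d → ℕ) (p : MvPolynomial (Fin d) ℂ)
    (z : Fin d → ℂ) : ℂ :=
  MvPolynomial.eval z (reflection n p) / MvPolynomial.eval z p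

/-- A polynomial is semi-stable if it has no zeros in the open polydisk. -/
def IsSemiStable {d : ℕ} (p : MvPolynomial (Fin d) ℂ) : Prop :=
  ∀ z ∈ polydisk d, MvPolynomial.eval z p ≠ 0

/-- `T^k = T₁^{k₁} ⋯ T_d^{k_d}` for a tuple of (commuting) operators. -/
noncomputable def operatorPow {d : ℕ} {H : Type u} [NormedAddCommGroup H] [InnerProductSpace ℂ H]
    (T : Fin d → H →L[ℂ] H) (k : Fin d → ℕ) : H →L[ℂ] H :=
  (List.ofFn fun i => T i ^ k i).prod

/-- The scalar Schur–Agler class: `f` is analytic on the polydisk and `‖f(T)‖ ≤ 1` for every tuple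
`T` of commuting strict contractions on a common Hilbert space. Here `f(T) = ∑ₖ cₖ T^k`, where
`f(z) = ∑ₖ cₖ z^k` is the (unique) power series of `f` on the polydisk. -/
def IsSchurAgler {d : ℕ} (f : (Fin d → ℂ) → ℂ) : Prop :=
  AnalyticOnNhd ℂ f (polydisk d) ∧
  ∃ c : (Fin d → ℕ) → ℂ,
    (∀ z ∈ polydisk d, HasSum (fun k => c k * ∏ i, z i ^ k i) (f z)) ∧
    ∀ (H : Type u) [NormedAddCommGroup H] [InnerProductSpace ℂ H] [CompleteSpace H]
      (T : Fin d → H →L[ℂ] H),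
      (∀ i j, Commute (T i) (T j)) → (∀ i, ‖T i‖ < 1) →
        ∃ A : H →L[ℂ] H, HasSum (fun k => c k • operatorPow T k) A ∧ ‖A‖ ≤ 1

/-- A rational inner function on the polydisk: a rational function, analytic and bounded by one on
the polydisk, whose radial limits exist and are unimodular almost everywhere on the torus
(parametrised by angles). -/
def IsRationalInner {d : ℕ} (f : (Fin d → ℂ) → ℂ) : Prop :=
  (∃ a b : MvPolynomial (Fin d) ℂ, ∀ z ∈ polydisk d,
    MvPolynomial.eval z b ≠ 0 ∧ f z = MvPolynomial.eval z a / MvPolynomial.eval z b) ∧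
  AnalyticOnNhd ℂ f (polydisk d) ∧
  (∀ z ∈ polydisk d, ‖f z‖ ≤ 1) ∧
  ∀ᵐ θ : Fin d → ℝ, ∃ w : ℂ, ‖w‖ = 1 ∧
    Filter.Tendsto (fun r : ℝ => f fun i => r * Complex.exp (θ i * Complex.I))
      (nhdsWithin 1 (Set.Iio 1)) (nhds w)

/-- `p` is an eventual Agler denominator of order `n`: it is semi-stable and `z^n p̄(1/z) / p(z)`
is in the Schur–Agler class. (Since `p(0) ≠ 0`, analyticity of this quotient on the polydisk
forces `multiDegree p ≤ n`; this is recorded so that `reflection n p` is `z^n p̄(1/z)`.) -/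
def IsEventualAglerDenominator {d : ℕ} (n : Fin d → ℕ) (p : MvPolynomial (Fin d) ℂ) : Prop :=
  IsSemiStable p ∧ multiDegree p ≤ n ∧ IsSchurAgler.{u} (reflectionQuotient n p)

/-- `p` is an Agler denominator: it is semi-stable and `z^(deg p) p̄(1/z) / p(z)` is in the
Schur–Agler class. -/
def IsAglerDenominator {d : ℕ} (p : MvPolynomial (Fin d) ℂ) : Prop :=
  IsSemiStable p ∧ IsSchurAgler.{u} (reflectionQuotient (multiDegree p) p)

/-! The function is the determinant of the transfer function of a unitary colligation. With `defect
K` = √(I - K*K), the block matrix `juliaMatrix K` is unitary, and it has determinant exactly 1.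
Comparing two evaluations of one block determinant then gives det(I - KZ) · det(transfer matrix) =
det(Z - K*) (`IsContraction.det_transfer`). The right side is the reflection of det(I - KZ), by det
Z · det(I - Z⁻¹K*) = det(Z - K*).

For the Schur–Agler bound, the resolvent (I - KZ)⁻¹ is built as a matrix of power series with
coefficients bounded by 1, so a commuting tuple T of strict contractions can be substituted. Energy
balance for the unitary colligation makes the transfer matrix at T a contraction on H^|n|
(`IsContraction.sum_norm_sq_transferSeries_le`). Its entries commute, so its determinant makes
sense, and this determinant is again a contraction: it is read off from a tensor power acting on an
antisymmetric vector (`norm_det_le_one_of_contractive`).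

The bound on the polydisk is the case H = ℂ. The boundary values are unimodular wherever p ≠ 0 on
the torus, hence almost everywhere, since p(0) ≠ 0. -/

/-! ### Defect operators, the Julia matrix and the determinant identity. -/

section LinearAlgebra

open Matrix
open scoped ComplexOrder

variable {ι : Type*} [Fintype ι] [DecidableEq ι]

theorem IsContraction.conjTranspose {K : Matrix ι ι ℂ} (hK : IsContraction K) :
    IsContraction Kᴴ := by
  unfold IsContraction at *
  rw [← Matrix.star_eq_conjTranspose, map_star, norm_star]
  exact hK

theorem IsContraction.sum_norm_sq_mulVec_le {K : Matrix ι ι ℂ} (hK : IsContraction K)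
    (v : ι → ℂ) : ∑ a, ‖(K *ᵥ v) a‖ ^ 2 ≤ ∑ a, ‖v a‖ ^ 2 := by
  have h := (Matrix.toEuclideanCLM (𝕜 := ℂ) K).le_of_opNorm_le hK (WithLp.toLp 2 v)
  rw [one_mul, toEuclideanCLM_toLp] at h
  have h2 := pow_le_pow_left₀ (norm_nonneg _) h 2
  rwa [EuclideanSpace.norm_sq_eq, EuclideanSpace.norm_sq_eq] at h2

omit [DecidableEq ι] in
theorem star_dotProduct_self_eq_sum (v : ι → ℂ) :
    star v ⬝ᵥ v = ((∑ a, ‖v a‖ ^ 2 : ℝ) : ℂ) := by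
  simp [dotProduct, Complex.conj_mul']

theorem IsContraction.one_sub_nonneg {K : Matrix ι ι ℂ} (hK : IsContraction K) :
    0 ≤ 1 - Kᴴ * K := by
  rw [Matrix.nonneg_iff_posSemidef]
  refine Matrix.PosSemidef.of_dotProduct_mulVec_nonneg
    (Matrix.isHermitian_one.sub (Matrix.isHermitian_conjTranspose_mul_self K)) fun v => ?_
  rw [Matrix.sub_mulVec, Matrix.one_mulVec, dotProduct_sub, ← Matrix.mulVec_mulVec,
    Matrix.dotProduct_mulVec, ← Matrix.star_mulVec, star_dotProduct_self_eq_sum,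
    star_dotProduct_self_eq_sum, ← Complex.ofReal_sub, Complex.zero_le_real]
  exact sub_nonneg.2 (hK.sum_norm_sq_mulVec_le v)

/-- The defect operator `√(I - K*K)`. -/
noncomputable def defect (K : Matrix ι ι ℂ) : Matrix ι ι ℂ := CFC.sqrt (1 - Kᴴ * K)

theorem defect_posSemidef (K : Matrix ι ι ℂ) : (defect K).PosSemidef :=
  Matrix.nonneg_iff_posSemidef.1 (CFC.sqrt_nonneg _)

theorem conjTranspose_defect (K : Matrix ι ι ℂ) : (defect K)ᴴ = defect K :=
  (defect_posSemidef K).isHermitian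

theorem IsContraction.defect_mul_self {K : Matrix ι ι ℂ} (hK : IsContraction K) :
    defect K * defect K = 1 - Kᴴ * K :=
  CFC.sqrt_mul_sqrt_self _ hK.one_sub_nonneg

theorem Matrix.PosSemidef.fromBlocks_zero {κ : Type*} [Fintype κ] [DecidableEq κ]
    {A : Matrix ι ι ℂ} {B : Matrix κ κ ℂ} (hA : A.PosSemidef) (hB : B.PosSemidef) :
    (Matrix.fromBlocks A 0 0 B).PosSemidef := by
  obtain ⟨E, rfl⟩ := CStarAlgebra.nonneg_iff_eq_star_mul_self.1 (Matrix.nonneg_iff_posSemidef.2 hA)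
  obtain ⟨G, rfl⟩ := CStarAlgebra.nonneg_iff_eq_star_mul_self.1 (Matrix.nonneg_iff_posSemidef.2 hB)
  rw [star_eq_conjTranspose, star_eq_conjTranspose]
  have : Matrix.fromBlocks (Eᴴ * E) 0 0 (Gᴴ * G) =
      (Matrix.fromBlocks E 0 0 G)ᴴ * Matrix.fromBlocks E 0 0 G := by
    simp [Matrix.fromBlocks_conjTranspose, Matrix.fromBlocks_multiply]
  rw [this]
  exact Matrix.posSemidef_conjTranspose_mul_self _

/-- The identity K(I - K*K) = (I - KK*)K passes to square roots: placing K off the diagonal of a 2 ×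
2 block matrix turns the intertwining into a commutation, and the square root of a positive matrix
commutes with whatever the matrix commutes with. -/
theorem IsContraction.mul_defect {K : Matrix ι ι ℂ} (hK : IsContraction K) :
    K * defect K = defect Kᴴ * K := by
  have h1 := hK.defect_mul_self
  have h2 := hK.conjTranspose.defect_mul_self
  rw [conjTranspose_conjTranspose] at h2
  set A : Matrix (ι ⊕ ι) (ι ⊕ ι) ℂ := fromBlocks (1 - K * Kᴴ) 0 0 (1 - Kᴴ * K) with hA
  set B : Matrix (ι ⊕ ι) (ι ⊕ ι) ℂ := fromBlocks (defect Kᴴ) 0 0 (defect K) with hB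
  set X : Matrix (ι ⊕ ι) (ι ⊕ ι) ℂ := fromBlocks 0 K 0 0 with hX
  have hsq : CFC.sqrt A = B := by
    refine CFC.sqrt_unique ?_ ?_
    · rw [hA, hB, fromBlocks_multiply, h1, h2]; simp
    · exact Matrix.nonneg_iff_posSemidef.2
        ((defect_posSemidef _).fromBlocks_zero (defect_posSemidef _))
  have hcomm : Commute A X := by
    rw [commute_iff_eq, hA, hX, fromBlocks_multiply, fromBlocks_multiply]
    simp [mul_sub, sub_mul, mul_assoc]
  have h3 : Commute B X := by
    rw [← hsq]
    exact hcomm.cfcₙ_nnreal _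
  rw [commute_iff_eq, hB, hX, fromBlocks_multiply, fromBlocks_multiply] at h3
  simpa using (fromBlocks_inj.1 h3).2.1.symm

theorem IsContraction.conjTranspose_mul_defect {K : Matrix ι ι ℂ} (hK : IsContraction K) :
    Kᴴ * defect Kᴴ = defect K * Kᴴ := by
  simpa using hK.conjTranspose.mul_defect

/-- The Julia matrix of a contraction. -/
noncomputable def juliaMatrix (K : Matrix ι ι ℂ) : Matrix (ι ⊕ ι) (ι ⊕ ι) ℂ :=
  fromBlocks (defect Kᴴ) K (-Kᴴ) (defect K)

theorem IsContraction.conjTranspose_juliaMatrix_mul {K : Matrix ι ι ℂ} (hK : IsContraction K) :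
    (juliaMatrix K)ᴴ * juliaMatrix K = 1 := by
  have h2 := hK.conjTranspose.defect_mul_self
  rw [conjTranspose_conjTranspose] at h2
  rw [juliaMatrix, fromBlocks_conjTranspose, fromBlocks_multiply, conjTranspose_defect,
    conjTranspose_defect, conjTranspose_neg, conjTranspose_conjTranspose, h2,
    hK.defect_mul_self, hK.conjTranspose_mul_defect, ← hK.mul_defect, ← fromBlocks_one]
  simp

/-- The shift by t makes the diagonal blocks invertible, so a Schur complement is available even
when the defects are singular. -/
theorem IsContraction.det_juliaMatrix_add_smul_pos {K : Matrix ι ι ℂ} (hK : IsContraction K)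
    {t : ℝ} (ht : 0 < t) : 0 < (juliaMatrix K + (t : ℂ) • 1).det := by
  have htc : (0 : ℂ) < t := by exact_mod_cast ht
  have hpd : ∀ L : Matrix ι ι ℂ, (defect L + (t : ℂ) • 1).PosDef := fun L =>
    Matrix.PosDef.posSemidef_add (defect_posSemidef L) (Matrix.PosDef.one.smul htc)
  set P := defect K + (t : ℂ) • 1 with hP
  set Q := defect Kᴴ + (t : ℂ) • 1 with hQ
  have hPu : IsUnit P := (hpd K).isUnit
  have hPdet : IsUnit P.det := (Matrix.isUnit_iff_isUnit_det _).1 hPu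
  have : Invertible P := hPu.invertible
  have hint : P * Kᴴ = Kᴴ * Q := by
    rw [hP, hQ, add_mul, mul_add, hK.conjTranspose_mul_defect]; simp
  have hint' : P⁻¹ * Kᴴ * Q = Kᴴ := by
    rw [mul_assoc, ← hint, ← mul_assoc, Matrix.nonsing_inv_mul _ hPdet, one_mul]
  have hV : juliaMatrix K + (t : ℂ) • 1 = fromBlocks Q K (-Kᴴ) P := by
    rw [juliaMatrix, ← fromBlocks_one, fromBlocks_smul, fromBlocks_add]; simp [hP, hQ]
  have h2 := hK.conjTranspose.defect_mul_self
  rw [conjTranspose_conjTranspose] at h2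
  -- The Schur complement Q + K P⁻¹ K*, times Q, is Q² + KK*, because P⁻¹K*Q = K*; and Q² + KK* = 1
  -- + 2t √(I - KK*) + t².
  have hkey : (juliaMatrix K + (t : ℂ) • 1).det * Q.det =
      P.det * (1 + ((2 * t : ℂ) • defect Kᴴ + (t ^ 2 : ℂ) • 1)).det := by
    rw [hV, det_fromBlocks₂₂, invOf_eq_nonsing_inv, mul_assoc, ← det_mul]
    congr 2
    rw [sub_mul, mul_neg, neg_mul, sub_neg_eq_add, mul_assoc K, mul_assoc K, hint']
    rw [hQ]
    simp only [add_mul, mul_add, h2, smul_mul_assoc, mul_smul_comm, one_mul, mul_one]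
    module
  have hpos : 0 < (1 + ((2 * t : ℂ) • defect Kᴴ + (t ^ 2 : ℂ) • (1 : Matrix ι ι ℂ))).det := by
    refine Matrix.PosDef.det_pos (Matrix.PosDef.add_posSemidef Matrix.PosDef.one ?_)
    refine Matrix.PosSemidef.add ((defect_posSemidef _).smul (by positivity))
      (Matrix.PosSemidef.one.smul (by positivity))
  have hQpos := (hpd Kᴴ).det_pos
  have : (juliaMatrix K + (t : ℂ) • 1).det =
      P.det * (1 + ((2 * t : ℂ) • defect Kᴴ + (t ^ 2 : ℂ) • 1)).det / Q.det := by
    rw [← hkey, mul_div_cancel_right₀ _ hQpos.ne']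
  rw [this]
  exact div_pos (mul_pos (hpd K).det_pos hpos) hQpos

/-- Letting t → 0 shows that the determinant is nonnegative, and unitarity makes it unimodular. -/
theorem IsContraction.det_juliaMatrix {K : Matrix ι ι ℂ} (hK : IsContraction K) :
    (juliaMatrix K).det = 1 := by
  have hc : Continuous fun t : ℝ => (juliaMatrix K + (t : ℂ) • 1).det := by fun_prop
  have ht : Filter.Tendsto (fun t : ℝ => (juliaMatrix K + (t : ℂ) • 1).det)
      (nhdsWithin 0 (Set.Ioi 0)) (nhds (juliaMatrix K).det) := by
    have := (hc.tendsto 0).mono_left (nhdsWithin_le_nhds (s := Set.Ioi 0))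
    simpa using this
  have h0 : 0 ≤ (juliaMatrix K).det := ge_of_tendsto ht <| by
    filter_upwards [self_mem_nhdsWithin] with t ht
    exact (hK.det_juliaMatrix_add_smul_pos ht).le
  have h1 : star (juliaMatrix K).det * (juliaMatrix K).det = 1 := by
    rw [← det_conjTranspose, ← det_mul, hK.conjTranspose_juliaMatrix_mul, det_one]
  obtain ⟨r, hr, hr'⟩ := RCLike.nonneg_iff_exists_ofReal.1 h0
  rw [← hr'] at h1 ⊢
  have : r * r = 1 := by
    simpa [← Complex.ofReal_mul] using congrArg Complex.re h1
  have : r = 1 := by nlinarith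
  simp [this]

theorem IsContraction.det_transfer {K : Matrix ι ι ℂ} (hK : IsContraction K) (Z : Matrix ι ι ℂ)
    (hZ : (1 - K * Z).det ≠ 0) :
    (1 - K * Z).det * (-Kᴴ + defect K * Z * (1 - K * Z)⁻¹ * defect Kᴴ).det = (Z - Kᴴ).det := by
  have : Invertible (1 - K * Z) := Matrix.invertibleOfIsUnitDet _ (isUnit_iff_ne_zero.2 hZ)
  have h2 := hK.conjTranspose.defect_mul_self
  rw [conjTranspose_conjTranspose] at h2
  have hW : (fromBlocks (1 - K * Z) (defect Kᴴ) (-(defect K * Z)) (-Kᴴ)).det =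
      (1 - K * Z).det * (-Kᴴ + defect K * Z * (1 - K * Z)⁻¹ * defect Kᴴ).det := by
    rw [det_fromBlocks₁₁, invOf_eq_nonsing_inv]
    simp
  -- Unitarity collapses the product of the first two factors to blocks `defect Kᴴ`, 1, K* - Z, 0;
  -- the unipotent factor is a column operation that turns the corner into 1.
  have hmul : (juliaMatrix K)ᴴ * fromBlocks (1 - K * Z) (defect Kᴴ) (-(defect K * Z)) (-Kᴴ) *
      fromBlocks 1 0 (1 - defect Kᴴ) 1 = fromBlocks 1 1 (Kᴴ - Z) 0 := by
    have e1 : defect Kᴴ * (K * Z) = K * (defect K * Z) := by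
      rw [← mul_assoc, ← hK.mul_defect, mul_assoc]
    have e2 : defect K * (defect K * Z) = Z - Kᴴ * (K * Z) := by
      rw [← mul_assoc, hK.defect_mul_self, sub_mul, one_mul, mul_assoc]
    rw [juliaMatrix, fromBlocks_conjTranspose, fromBlocks_multiply, fromBlocks_multiply,
      conjTranspose_defect, conjTranspose_defect, conjTranspose_neg, conjTranspose_conjTranspose]
    congr 1 <;>
      simp only [mul_sub, mul_neg, neg_mul, mul_one, mul_zero, neg_neg, e1, e2, h2,
        hK.conjTranspose_mul_defect] <;>
      simp
  have hdet := congrArg Matrix.det hmul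
  rw [det_mul, det_mul, hW, det_fromBlocks_zero₁₂, det_fromBlocks_one₁₁, det_conjTranspose,
    hK.det_juliaMatrix] at hdet
  simpa using hdet

theorem sum_norm_sq_of_conjTranspose_mul_self {H : Type*} [NormedAddCommGroup H]
    [InnerProductSpace ℂ H] {U : Matrix ι ι ℂ} (hU : Uᴴ * U = 1) (v : ι → H) :
    ∑ a, ‖∑ b, U a b • v b‖ ^ 2 = ∑ a, ‖v a‖ ^ 2 := by
  have key : (∑ a, inner ℂ (∑ b, U a b • v b) (∑ b, U a b • v b)) = ∑ a, inner ℂ (v a) (v a) :=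
    calc (∑ a, inner ℂ (∑ b, U a b • v b) (∑ b, U a b • v b))
        = ∑ a, ∑ b, ∑ c, star (U a b) * U a c * inner ℂ (v b) (v c) := by
          refine Finset.sum_congr rfl fun a _ => ?_
          rw [sum_inner]
          refine Finset.sum_congr rfl fun b _ => ?_
          rw [inner_sum]
          refine Finset.sum_congr rfl fun c _ => ?_
          rw [inner_smul_left, inner_smul_right, mul_assoc]
          rfl
      _ = ∑ b, ∑ c, (1 : Matrix ι ι ℂ) b c * inner ℂ (v b) (v c) := by
          rw [Finset.sum_comm]
          refine Finset.sum_congr rfl fun b _ => ?_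
          rw [Finset.sum_comm]
          refine Finset.sum_congr rfl fun c _ => ?_
          rw [← hU, Matrix.mul_apply, Finset.sum_mul]
          rfl
      _ = ∑ a, inner ℂ (v a) (v a) := by simp [Matrix.one_apply]
  simp only [inner_self_eq_norm_sq_to_K] at key
  exact_mod_cast key

end LinearAlgebra

/-! ### The determinantal polynomial, its reflection, and its zeros. -/

section Polynomials

open MvPolynomial
open Matrix hiding blockDiag blockDiag_map

variable {d : ℕ} (n : Fin d → ℕ) (K : Matrix (Σ i, Fin (n i)) (Σ i, Fin (n i)) ℂ)

theorem map_blockDiag {R S : Type*} [CommRing R] [CommRing S] (f : R →+* S) (z : Fin d → R) :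
    (blockDiag n z).map f = blockDiag n fun i => f (z i) := by
  rw [blockDiag, blockDiag, Matrix.diagonal_map (map_zero f)]

theorem det_blockDiag (z : Fin d → ℂ) : (blockDiag n z).det = ∏ i, z i ^ n i := by
  rw [blockDiag, det_diagonal, Fintype.prod_sigma]
  simp

theorem eval_detRep (z : Fin d → ℂ) :
    eval z (detRep n K) = (1 - K * blockDiag n z).det := by
  rw [detRep, RingHom.map_det, RingHom.mapMatrix_apply]
  congr 1
  rw [Matrix.map_sub _ (map_sub _), Matrix.map_mul, Matrix.map_one _ (map_zero _) (map_one _),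
    map_blockDiag, Matrix.map_map]
  congr 2
  · ext; simp
  · simp

/-- The variable zᵢ occurs only in the nᵢ columns of block i, to degree at most one in each entry.
-/
theorem multiDegree_detRep_le : multiDegree (detRep n K) ≤ n := by
  intro i
  rw [multiDegree, detRep, det_apply]
  refine (degreeOf_sum_le _ _ _).trans (Finset.sup_le fun σ _ => ?_)
  have hentry : ∀ a b : Σ i, Fin (n i), degreeOf i ((1 - K.map C *
      blockDiag n X : Matrix _ _ (MvPolynomial (Fin d) ℂ)) a b) ≤ if b.1 = i then 1 else 0 := fun a b => by
    rw [Matrix.sub_apply, blockDiag, mul_diagonal, Matrix.map_apply]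
    refine (degreeOf_sub_le _ _ _).trans (max_le ?_ ?_)
    · rw [Matrix.one_apply]
      split_ifs <;> simp
    · refine (degreeOf_mul_le _ _ _).trans ?_
      rw [degreeOf_C, zero_add, degreeOf_X]
      simp only [eq_comm, le_refl]
  have hsmul : ∀ q : MvPolynomial (Fin d) ℂ,
      degreeOf i (Equiv.Perm.sign σ • q) ≤ degreeOf i q := fun q => by
    rcases Int.units_eq_one_or (Equiv.Perm.sign σ) with h | h <;> rw [h] <;> simp
  refine (hsmul _).trans ((degreeOf_prod_le _ _ _).trans
    ((Finset.sum_le_sum fun b _ => hentry (σ b) b).trans ?_))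
  rw [Fintype.sum_sigma]
  simp [apply_ite Finset.card]

theorem eval_reflection_detRep (z : Fin d → ℂ) :
    eval z (reflection n (detRep n K)) = (blockDiag n z - Kᴴ).det := by
  have hpoly : reflection n (detRep n K) = (blockDiag n X - Kᴴ.map C).det := by
    have heval : ∀ z : Fin d → ℂ, eval z (blockDiag n X - Kᴴ.map C).det =
        (blockDiag n z - Kᴴ).det := fun z => by
      rw [RingHom.map_det, RingHom.mapMatrix_apply, Matrix.map_sub _ (map_sub _), map_blockDiag,
        Matrix.map_map]
      congr 2
      · simp
      · ext; simp
    -- Inverting z requires nonzero coordinates; multiplying by ∏ Xᵢ makes the identity trivial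
    -- elsewhere, and this factor cancels in the polynomial ring.
    have hX : (∏ i, X i : MvPolynomial (Fin d) ℂ) ≠ 0 :=
      Finset.prod_ne_zero_iff.2 fun i _ => X_ne_zero i
    refine mul_right_cancel₀ hX (MvPolynomial.funext fun z => ?_)
    rw [map_mul, map_mul, heval]
    by_cases hz : ∀ i, z i ≠ 0
    · congr 1
      rw [eval_reflection n _ (multiDegree_detRep_le n K) z hz, eval_detRep, ← det_blockDiag,
        ← det_conjTranspose, ← det_mul]
      congr 1
      rw [conjTranspose_sub, conjTranspose_one, conjTranspose_mul, mul_sub, mul_one, ← mul_assoc]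
      congr 1
      have : blockDiag n z * (blockDiag n fun i => star (1 / z i))ᴴ = 1 := by
        rw [blockDiag, blockDiag, diagonal_conjTranspose, diagonal_mul_diagonal, ← diagonal_one]
        congr 1
        ext a
        simp [hz a.1]
      rw [this, one_mul]
    · push Not at hz
      obtain ⟨i, hi⟩ := hz
      have : eval z (∏ i, X i : MvPolynomial (Fin d) ℂ) = 0 := by
        rw [map_prod]
        exact Finset.prod_eq_zero (Finset.mem_univ i) (by simpa using hi)
      rw [this, mul_zero, mul_zero]
  rw [hpoly, RingHom.map_det, RingHom.mapMatrix_apply, Matrix.map_sub _ (map_sub _), map_blockDiag,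
    Matrix.map_map]
  congr 2
  · simp
  · ext; simp

theorem transferMatrix_eq (z : Fin d → ℂ) : transferMatrix n K z =
    -Kᴴ + defect K * blockDiag n z * (1 - K * blockDiag n z)⁻¹ * defect Kᴴ := by
  rw [transferMatrix, defect, defect, conjTranspose_conjTranspose]

variable {n K}

theorem IsContraction.reflectionQuotient_eq_det (hK : IsContraction K) {z : Fin d → ℂ}
    (hz : eval z (detRep n K) ≠ 0) :
    reflectionQuotient n (detRep n K) z = (transferMatrix n K z).det := by
  rw [reflectionQuotient, div_eq_iff hz, eval_reflection_detRep, transferMatrix_eq]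
  rw [eval_detRep] at hz ⊢
  rw [mul_comm, hK.det_transfer _ hz]

theorem IsContraction.isSemiStable (hK : IsContraction K) : IsSemiStable (detRep n K) := by
  intro z hz h0
  rw [eval_detRep] at h0
  -- A kernel vector satisfies v = KZv, so ‖v‖ ≤ ‖Zv‖ < ‖v‖.
  obtain ⟨v, hv, hv0⟩ := exists_mulVec_eq_zero_iff.2 h0
  rw [sub_mulVec, one_mulVec, sub_eq_zero, ← mulVec_mulVec] at hv0
  have h1 := hK.sum_norm_sq_mulVec_le (blockDiag n z *ᵥ v)
  rw [← hv0] at h1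
  obtain ⟨a, ha⟩ : ∃ a, v a ≠ 0 := by
    by_contra! h
    exact hv (funext h)
  refine absurd h1 (not_le.2 (Finset.sum_lt_sum (fun b _ => ?_) ⟨a, Finset.mem_univ a, ?_⟩))
  · rw [blockDiag, mulVec_diagonal, norm_mul, mul_pow]
    exact mul_le_of_le_one_left (by positivity) (pow_le_one₀ (norm_nonneg _) (hz _).le)
  · rw [blockDiag, mulVec_diagonal, norm_mul, mul_pow]
    exact mul_lt_of_lt_one_left (by positivity) (pow_lt_one₀ (norm_nonneg _) (hz _) two_ne_zero)

theorem norm_reflectionQuotient_eq_one {p : MvPolynomial (Fin d) ℂ} (hp : multiDegree p ≤ n)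
    {z : Fin d → ℂ} (hz : ∀ i, ‖z i‖ = 1) (h0 : eval z p ≠ 0) :
    ‖reflectionQuotient n p z‖ = 1 := by
  have hz0 : ∀ i, z i ≠ 0 := fun i => norm_ne_zero_iff.1 (by rw [hz i]; exact one_ne_zero)
  have hstar : (fun i => star (1 / z i)) = z := by
    ext i
    rw [one_div, Complex.inv_def, Complex.normSq_eq_norm_sq, hz i]
    simp
  rw [reflectionQuotient, eval_reflection n p hp z hz0, hstar, norm_div, norm_mul, norm_star,
    norm_prod]
  simp [hz, h0]

/-- By Fubini along the diagonal direction θ + t(1, …, 1): on each such line p becomes a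
one-variable polynomial in e^{it} whose value at 0 is p(0) ≠ 0, so it vanishes for only countably
many t. -/
theorem ae_torus_eval_ne_zero (p : MvPolynomial (Fin d) ℂ) (hp : eval 0 p ≠ 0) :
    ∀ᵐ θ : Fin d → ℝ, eval (fun i => Complex.exp (θ i * Complex.I)) p ≠ 0 := by
  have hcont : Continuous fun θ : Fin d → ℝ =>
      eval (fun i => Complex.exp (θ i * Complex.I)) p :=
    (MvPolynomial.continuous_eval p).comp (by fun_prop)
  let L : ℝ →ₗ[ℝ] (Fin d → ℝ) := LinearMap.pi fun _ => LinearMap.id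
  refine MeasureTheory.ae_mem_of_ae_add_linearMap_mem (μ := MeasureTheory.volume) L
    MeasureTheory.volume
    (s := {θ | eval (fun i => Complex.exp (θ i * Complex.I)) p ≠ 0})
    (isOpen_ne.preimage hcont).measurableSet fun y => ?_
  let q : Polynomial ℂ :=
    aeval (fun i => Polynomial.C (Complex.exp (y i * Complex.I)) * Polynomial.X) p
  have hq : ∀ w, q.eval w = eval (fun i => Complex.exp (y i * Complex.I) * w) p := fun w => by
    rw [← Polynomial.coe_aeval_eq_eval, comp_aeval_apply, ← aeval_eq_eval]
    simp
  have hq0 : q ≠ 0 := fun h => hp <| by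
    have := hq 0
    simp only [h, mul_zero, Polynomial.eval_zero] at this
    exact this.symm
  have hfin : {w | q.eval w = 0}.Finite := by
    simpa [Polynomial.IsRoot] using Polynomial.finite_setOfPred_isRoot hq0
  have hcount : {t : ℝ | q.eval (Complex.exp (t * Complex.I)) = 0}.Countable := by
    refine (hfin.countable.preimage_cexp).preimage_of_injOn
      (f := fun t : ℝ => (t * Complex.I : ℂ)) fun a _ b _ h => ?_
    simpa using h
  filter_upwards [hcount.ae_notMem MeasureTheory.volume] with t ht
  change q.eval _ ≠ 0 at ht
  rw [hq] at ht
  convert! ht using 4 with i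
  rw [← Complex.exp_add]
  simp [L, add_mul]

end Polynomials

/-! ### Monomials in commuting operators. -/

section OperatorPow

variable {d : ℕ} {H : Type u} [NormedAddCommGroup H] [InnerProductSpace ℂ H]
  {T : Fin d → H →L[ℂ] H}

theorem operatorPow_zero (T : Fin d → H →L[ℂ] H) : operatorPow T 0 = 1 := by
  simp [operatorPow]

theorem operatorPow_add (hT : ∀ i j, Commute (T i) (T j)) (k l : Fin d → ℕ) :
    operatorPow T (k + l) = operatorPow T k * operatorPow T l := by
  induction d with
  | zero => simp [operatorPow]
  | succ d ih =>
    have h := ih (T := fun i => T i.succ) (fun i j => hT _ _) (fun i => k i.succ) fun i => l i.succ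
    simp only [operatorPow, Pi.add_apply, List.ofFn_succ, List.prod_cons] at h ⊢
    rw [h, pow_add]
    have hcomm : Commute (T 0 ^ l 0) (List.ofFn fun i : Fin d => T i.succ ^ k i.succ).prod := by
      refine Commute.list_prod_right _ _ fun x hx => ?_
      obtain ⟨i, rfl⟩ := (List.mem_ofFn' _ _).1 hx
      exact (hT _ _).pow_pow _ _
    rw [mul_assoc, ← mul_assoc (T 0 ^ l 0), hcomm.eq]
    simp only [mul_assoc]

theorem operatorPow_single (T : Fin d → H →L[ℂ] H) (i : Fin d) :
    operatorPow T (Pi.single i 1) = T i := by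
  induction d with
  | zero => exact i.elim0
  | succ d ih =>
    rw [operatorPow, List.ofFn_succ, List.prod_cons]
    induction i using Fin.cases with
    | zero =>
      simp
    | succ i =>
      have := ih (fun j => T j.succ) i
      rw [operatorPow] at this
      simpa [Pi.single_apply] using this

theorem norm_operatorPow_le {r : ℝ} (hr : ∀ i, ‖T i‖ ≤ r) (k : Fin d → ℕ) :
    ‖operatorPow T k‖ ≤ r ^ ∑ i, k i := by
  induction d with
  | zero =>
    simp only [operatorPow, List.ofFn_zero, List.prod_nil, Finset.univ_eq_empty, Finset.sum_empty,
      pow_zero]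
    exact ContinuousLinearMap.norm_id_le
  | succ d ih =>
    have h := ih (T := fun i => T i.succ) (fun i => hr _) fun i => k i.succ
    have hr0 : 0 ≤ r := (norm_nonneg _).trans (hr 0)
    have hpow : ∀ m : ℕ, ‖T 0 ^ m‖ ≤ r ^ m := fun m => by
      induction m with
      | zero =>
        rw [pow_zero, pow_zero]
        exact ContinuousLinearMap.norm_id_le
      | succ m ih =>
        rw [pow_succ, pow_succ]
        exact (norm_mul_le _ _).trans (mul_le_mul ih (hr 0) (norm_nonneg _) (by positivity))
    simp only [operatorPow, List.ofFn_succ, List.prod_cons, Fin.sum_univ_succ, pow_add] at h ⊢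
    exact (norm_mul_le _ _).trans (mul_le_mul (hpow _) h (norm_nonneg _) (by positivity))

end OperatorPow

/-! ### Absolutely convergent power series and their functional calculus. -/

section ConvergentSeries

open MvPowerSeries Finset

theorem summable_pow_degree (d : ℕ) {r : ℝ} (h0 : 0 ≤ r) (h1 : r < 1) :
    Summable fun k : Fin d →₀ ℕ => r ^ k.degree := by
  have hgeom := summable_geometric_of_lt_one h0 h1
  refine summable_of_sum_le (c := ∏ _i : Fin d, ∑' j, r ^ j) (fun k => by positivity) fun s => ?_
  let M := (s.sup Finsupp.degree) + 1
  have hinj : Function.Injective fun k : Fin d →₀ ℕ => (k : Fin d → ℕ) := DFunLike.coe_injective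
  calc ∑ k ∈ s, r ^ k.degree
      = ∑ k ∈ s, ∏ i, r ^ k i := by
        refine sum_congr rfl fun k _ => ?_
        rw [Finsupp.degree_eq_sum, prod_pow_eq_pow_sum]
    _ = ∑ k ∈ s.map ⟨_, hinj⟩, ∏ i, r ^ k i := by rw [sum_map]; rfl
    _ ≤ ∑ k ∈ Fintype.piFinset fun _ => range M, ∏ i, r ^ k i := by
        refine sum_le_sum_of_subset_of_nonneg (fun k hk => ?_) fun k _ _ => by positivity
        obtain ⟨l, hl, rfl⟩ := mem_map.1 hk
        rw [Fintype.mem_piFinset]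
        intro i
        exact mem_range.2 (Nat.lt_succ_of_le ((Finsupp.le_degree i l).trans (le_sup hl)))
    _ = ∏ _i : Fin d, ∑ j ∈ range M, r ^ j := (prod_univ_sum _ _).symm
    _ ≤ ∏ _i : Fin d, ∑' j, r ^ j :=
        prod_le_prod (fun i _ => by positivity) fun i _ =>
          hgeom.sum_le_tsum _ fun j _ => by positivity

theorem summable_norm_coeff_mul {d : ℕ} {φ ψ : MvPowerSeries (Fin d) ℂ} {r : ℝ} (h0 : 0 ≤ r)
    (hφ : Summable fun k : Fin d →₀ ℕ => ‖coeff k φ‖ * r ^ k.degree)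
    (hψ : Summable fun k : Fin d →₀ ℕ => ‖coeff k ψ‖ * r ^ k.degree) :
    Summable fun k : Fin d →₀ ℕ => ‖coeff k (φ * ψ)‖ * r ^ k.degree := by
  have hpos : ∀ (χ : MvPowerSeries (Fin d) ℂ) (k : Fin d →₀ ℕ),
      0 ≤ ‖coeff k χ‖ * r ^ k.degree := fun χ k => by positivity
  have h := summable_sum_mul_antidiagonal_of_summable_mul
    (Summable.mul_of_nonneg hφ hψ (hpos φ) (hpos ψ))
  refine h.of_nonneg_of_le (hpos _) fun k => ?_
  rw [coeff_mul]
  calc ‖∑ x ∈ antidiagonal k, coeff x.1 φ * coeff x.2 ψ‖ * r ^ k.degree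
      ≤ (∑ x ∈ antidiagonal k, ‖coeff x.1 φ * coeff x.2 ψ‖) * r ^ k.degree := by
        gcongr
        exact norm_sum_le _ _
    _ = _ := by
        rw [sum_mul]
        refine sum_congr rfl fun x hx => ?_
        rw [← mem_antidiagonal.1 hx, map_add, pow_add, norm_mul]
        ring

/-- The ring of power series which converge absolutely on the open unit polydisk. -/
def convergentSeries (d : ℕ) : Subring (MvPowerSeries (Fin d) ℂ) where
  carrier := {φ | ∀ r : ℝ, 0 ≤ r → r < 1 → Summable fun k => ‖coeff k φ‖ * r ^ k.degree}
  zero_mem' r _ _ := by simp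
  one_mem' r _ _ := by
    refine summable_of_ne_finset_zero (s := {0}) fun k hk => ?_
    rw [coeff_one, if_neg (by simpa using hk)]
    simp
  add_mem' {φ ψ} hφ hψ r h0 h1 := by
    refine ((hφ r h0 h1).add (hψ r h0 h1)).of_nonneg_of_le (fun k => by positivity) fun k => ?_
    rw [map_add, ← add_mul]
    gcongr
    exact norm_add_le _ _
  neg_mem' {φ} hφ r h0 h1 := by simpa using hφ r h0 h1
  mul_mem' {φ ψ} hφ hψ r h0 h1 := summable_norm_coeff_mul h0 (hφ r h0 h1) (hψ r h0 h1)

theorem mem_convergentSeries_of_norm_coeff_le {d : ℕ} {φ : MvPowerSeries (Fin d) ℂ} {M : ℝ}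
    (h : ∀ k, ‖coeff k φ‖ ≤ M) : φ ∈ convergentSeries d := fun r h0 h1 =>
  ((summable_pow_degree d h0 h1).mul_left M).of_nonneg_of_le (fun k => by positivity) fun k => by
    gcongr
    exact h k

theorem C_mem_convergentSeries {d : ℕ} (a : ℂ) : C a ∈ convergentSeries d :=
  mem_convergentSeries_of_norm_coeff_le (M := ‖a‖) fun k => by
    rw [coeff_C]
    split_ifs <;> simp

theorem X_mem_convergentSeries {d : ℕ} (i : Fin d) : X i ∈ convergentSeries d :=
  mem_convergentSeries_of_norm_coeff_le (M := 1) fun k => by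
    rw [coeff_X]
    split_ifs <;> simp

variable {d : ℕ} {H : Type u} [NormedAddCommGroup H] [InnerProductSpace ℂ H]
  {T : Fin d → H →L[ℂ] H}

theorem summable_norm_coeff_smul_operatorPow (hT : ∀ i, ‖T i‖ < 1) {φ : MvPowerSeries (Fin d) ℂ}
    (hφ : φ ∈ convergentSeries d) : Summable fun k => ‖coeff k φ • operatorPow T k‖ := by
  let r := univ.sup fun i => ‖T i‖₊
  have h1 : r < 1 := (Finset.sup_lt_iff (by simp)).2 fun i _ => hT i
  have hr : ∀ i, ‖T i‖ ≤ (r : ℝ) := fun i => Finset.le_sup (f := fun i => ‖T i‖₊) (mem_univ i)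
  refine (hφ r r.2 h1).of_nonneg_of_le (fun k => norm_nonneg _) fun k => ?_
  rw [norm_smul, Finsupp.degree_eq_sum]
  gcongr
  exact norm_operatorPow_le hr k

theorem tsum_coeff_mul_smul_operatorPow [CompleteSpace H] (hc : ∀ i j, Commute (T i) (T j))
    (hT : ∀ i, ‖T i‖ < 1) {φ ψ : MvPowerSeries (Fin d) ℂ} (hφ : φ ∈ convergentSeries d)
    (hψ : ψ ∈ convergentSeries d) :
    ∑' k, coeff k (φ * ψ) • operatorPow T k =
      (∑' k, coeff k φ • operatorPow T k) * ∑' k, coeff k ψ • operatorPow T k := by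
  have hφ' := summable_norm_coeff_smul_operatorPow hT hφ
  have hψ' := summable_norm_coeff_smul_operatorPow hT hψ
  have hmul := summable_mul_of_summable_norm hφ' hψ'
  have key := Summable.tsum_mul_tsum_eq_tsum_sum_antidiagonal hφ'.of_norm hψ'.of_norm hmul
  rw [key]
  refine tsum_congr fun k => ?_
  rw [coeff_mul, sum_smul]
  refine sum_congr rfl fun x hx => ?_
  rw [← mem_antidiagonal.1 hx, Finsupp.coe_add, operatorPow_add hc, smul_mul_smul_comm]

/-- Evaluation of a power series at a tuple of commuting strict contractions. -/
noncomputable def evalSeries [CompleteSpace H] (T : Fin d → H →L[ℂ] H)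
    (hc : ∀ i j, Commute (T i) (T j)) (hT : ∀ i, ‖T i‖ < 1) :
    convergentSeries d →+* (H →L[ℂ] H) where
  toFun φ := ∑' k, coeff k φ.1 • operatorPow T k
  map_one' := by
    rw [tsum_eq_single 0 fun k hk => by
      rw [OneMemClass.coe_one, coeff_one, if_neg hk, zero_smul]]
    simp [operatorPow_zero]
  map_zero' := by simp
  map_add' φ ψ := by
    simp only [Subring.coe_add, map_add, add_smul]
    exact (summable_norm_coeff_smul_operatorPow hT φ.2).of_norm.tsum_add
      (summable_norm_coeff_smul_operatorPow hT ψ.2).of_norm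
  map_mul' φ ψ := tsum_coeff_mul_smul_operatorPow hc hT φ.2 ψ.2

variable [CompleteSpace H] (hc : ∀ i j, Commute (T i) (T j)) (hT : ∀ i, ‖T i‖ < 1)

theorem hasSum_evalSeries (φ : convergentSeries d) :
    HasSum (fun k : Fin d →₀ ℕ => coeff k φ.1 • operatorPow T k) (evalSeries T hc hT φ) :=
  (summable_norm_coeff_smul_operatorPow hT φ.2).of_norm.hasSum

theorem evalSeries_C (a : ℂ) :
    evalSeries T hc hT ⟨C a, C_mem_convergentSeries a⟩ = a • 1 := by
  change ∑' k : Fin d →₀ ℕ, coeff k (C a) • operatorPow T k = _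
  rw [tsum_eq_single 0 fun k hk => by simp [coeff_C, hk]]
  simp [operatorPow_zero]

theorem evalSeries_X (i : Fin d) :
    evalSeries T hc hT ⟨X i, X_mem_convergentSeries i⟩ = T i := by
  change ∑' k : Fin d →₀ ℕ, coeff k (X i) • operatorPow T k = _
  rw [tsum_eq_single (Finsupp.single i 1) fun k hk => by simp [coeff_X, hk]]
  simp [coeff_X, Finsupp.single_eq_pi_single, operatorPow_single]

end ConvergentSeries

/-! ### Determinants of contractive matrices with commuting operator entries. -/

section CommutingEntries

open Finset Function

variable {ι : Type*} [Fintype ι] [DecidableEq ι] {S : Type*} [CommRing S]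
  {H : Type u} [NormedAddCommGroup H] [InnerProductSpace ℂ H]

/-- The action on `H^ι` of a matrix over a commutative ring acting on `H`. -/
def matrixAct (π : S →+* (H →L[ℂ] H)) (M : Matrix ι ι S) (v : ι → H) (a : ι) : H :=
  ∑ b, π (M a b) (v b)

variable (π : S →+* (H →L[ℂ] H))

omit [DecidableEq ι] in
theorem matrixAct_mul (M N : Matrix ι ι S) (v : ι → H) :
    matrixAct π (M * N) v = matrixAct π M (matrixAct π N v) := by
  ext a
  simp only [matrixAct, Matrix.mul_apply, map_sum, map_mul, _root_.sum_apply,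
    mul_apply_eq_comp]
  rw [sum_comm]

omit [DecidableEq ι] in
theorem matrixAct_add (M N : Matrix ι ι S) (v : ι → H) :
    matrixAct π (M + N) v = matrixAct π M v + matrixAct π N v := by
  ext a
  simp [matrixAct, sum_add_distrib]

theorem matrixAct_one (v : ι → H) : matrixAct π (1 : Matrix ι ι S) v = v := by
  ext a
  rw [matrixAct, sum_eq_single a]
  · simp
  · intro b _ hb
    simp [Matrix.one_apply_ne hb.symm]
  · simp

/-- Exchanging a with the j-th value of τ is an involution on pairs (τ, a). This reduces estimates
on leg j to single fibres. -/
theorem card_mul_sum_eq_sum_update (g : (ι → ι) → ℝ) (j : ι) :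
    Fintype.card ι * ∑ τ, g τ = ∑ τ, ∑ a, g (update τ j a) := by
  let e : (ι → ι) × ι ≃ (ι → ι) × ι :=
    Involutive.toPerm (fun x => (update x.1 j x.2, x.1 j)) fun x => by simp
  rw [← Fintype.sum_prod_type' fun τ a => g (update τ j a),
    ← e.sum_comp fun x => g (update x.1 j x.2), Fintype.sum_prod_type]
  have he : ∀ x, e x = (update x.1 j x.2, x.1 j) := fun _ => rfl
  simp [he, mul_sum]

/-- The matrix `M` acting on the `j`-th tensor factor of `(ℂ^ι)^{⊗ι} ⊗ H`. -/
def legAct (M : Matrix ι ι S) (j : ι) (v : (ι → ι) → H) (τ : ι → ι) : H :=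
  ∑ b, π (M (τ j) b) (v (update τ j b))

/-- The matrix `M` acting on the tensor factors in `s` of `(ℂ^ι)^{⊗ι} ⊗ H`. -/
def legsAct (M : Matrix ι ι S) (s : Finset ι) (v : (ι → ι) → H) (τ : ι → ι) : H :=
  ∑ σ : ι → ι, if ∀ i ∉ s, σ i = τ i then π (∏ i ∈ s, M (τ i) (σ i)) (v σ) else 0

theorem legsAct_empty (M : Matrix ι ι S) (v : (ι → ι) → H) : legsAct π M ∅ v = v := by
  ext τ
  simp [legsAct, ← funext_iff]

/-- Building the tensor power one leg at a time makes it a composition of contractions. -/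
theorem legsAct_insert (M : Matrix ι ι S) {s : Finset ι} {j : ι} (hj : j ∉ s)
    (v : (ι → ι) → H) : legsAct π M (insert j s) v = legAct π M j (legsAct π M s v) := by
  ext τ
  simp only [legsAct, legAct, map_sum]
  rw [sum_comm]
  refine sum_congr rfl fun σ _ => ?_
  rw [sum_eq_single (σ j)]
  · have hiff : (∀ i ∉ s, σ i = update τ j (σ j) i) ↔ ∀ i ∉ insert j s, σ i = τ i := by
      refine forall_congr' fun i => ?_
      by_cases hi : i = j <;> simp [hi]
    have hprod : ∏ i ∈ s, M (update τ j (σ j) i) (σ i) = ∏ i ∈ s, M (τ i) (σ i) :=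
      prod_congr rfl fun i hi => by rw [update_of_ne (ne_of_mem_of_not_mem hi hj)]
    simp only [hiff, hprod, prod_insert hj]
    split_ifs <;> simp
  · intro b _ hb
    rw [if_neg fun h => hb (by simpa using (h j hj).symm), map_zero]
  · simp

variable {π}

theorem sum_norm_sq_legAct_le {M : Matrix ι ι S}
    (hM : ∀ v : ι → H, ∑ a, ‖matrixAct π M v a‖ ^ 2 ≤ ∑ a, ‖v a‖ ^ 2) (j : ι)
    (v : (ι → ι) → H) : ∑ τ, ‖legAct π M j v τ‖ ^ 2 ≤ ∑ τ, ‖v τ‖ ^ 2 := by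
  have hcard : (0 : ℝ) < Fintype.card ι := by exact_mod_cast Fintype.card_pos_iff.2 ⟨j⟩
  refine le_of_mul_le_mul_left ?_ hcard
  rw [card_mul_sum_eq_sum_update _ j, card_mul_sum_eq_sum_update _ j]
  refine sum_le_sum fun τ _ => ?_
  refine le_trans (le_of_eq ?_) (hM fun a => v (update τ j a))
  simp [legAct, matrixAct]

theorem sum_norm_sq_legsAct_le {M : Matrix ι ι S}
    (hM : ∀ v : ι → H, ∑ a, ‖matrixAct π M v a‖ ^ 2 ≤ ∑ a, ‖v a‖ ^ 2) (s : Finset ι)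
    (v : (ι → ι) → H) : ∑ τ, ‖legsAct π M s v τ‖ ^ 2 ≤ ∑ τ, ‖v τ‖ ^ 2 := by
  induction s using Finset.induction_on with
  | empty => rw [legsAct_empty]
  | insert j s hj ih =>
    rw [legsAct_insert π M hj]
    exact (sum_norm_sq_legAct_le hM j _).trans ih

/-- The determinant of a contractive matrix with commuting operator entries is a contraction. -/
theorem norm_det_le_one_of_contractive {M : Matrix ι ι S}
    (hM : ∀ v : ι → H, ∑ a, ‖matrixAct π M v a‖ ^ 2 ≤ ∑ a, ‖v a‖ ^ 2) : ‖π M.det‖ ≤ 1 := by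
  refine ContinuousLinearMap.opNorm_le_bound _ zero_le_one fun h => ?_
  rw [one_mul]
  let sgn : Equiv.Perm ι → ℂ := fun e => ((Equiv.Perm.sign e : ℤ) : ℂ)
  have hsgn : ∀ e, ‖sgn e‖ = 1 := fun e => by
    rcases Int.units_eq_one_or (Equiv.Perm.sign e) with h | h <;> simp [sgn, h]
  have hinj : Injective fun e : Equiv.Perm ι => (e : ι → ι) := DFunLike.coe_injective
  -- The antisymmetric tensor ∑ sgn(e) e ⊗ h, supported on permutations, with squared norm |ι|!
  -- ‖h‖².
  let v : (ι → ι) → H := fun σ => ∑ e : Equiv.Perm ι, if (e : ι → ι) = σ then sgn e • h else 0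
  have hv : ∀ e : Equiv.Perm ι, v e = sgn e • h := fun e => by
    simp [v]
  have hv0 : ∀ σ, σ ∉ Set.range (fun e : Equiv.Perm ι => (e : ι → ι)) → v σ = 0 := fun σ hσ =>
    sum_eq_zero fun e _ => if_neg fun h => hσ ⟨e, h⟩
  have hsum : ∑ τ, ‖v τ‖ ^ 2 = Fintype.card (Equiv.Perm ι) * ‖h‖ ^ 2 := by
    rw [← Fintype.sum_of_injective _ hinj (fun _ => ‖h‖ ^ 2) _ (fun σ hσ => by simp [hv0 σ hσ])
      fun e => by simp [hv, norm_smul, hsgn]]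
    simp
  -- At a permutation e, the tensor power produces the Leibniz expansion of the determinant with
  -- rows permuted by e.
  have hact : ∀ e : Equiv.Perm ι, legsAct π M univ v e = sgn e • π M.det h := fun e => by
    have h1 : sgn e • π M.det h = π (M.submatrix e id).det h := by
      rw [Matrix.det_permute, map_mul, map_intCast, mul_apply_eq_comp]
      rcases Int.units_eq_one_or (Equiv.Perm.sign e) with h | h <;> simp [sgn, h]
    rw [h1, ← Matrix.det_transpose, Matrix.det_apply', map_sum, _root_.sum_apply,
      legsAct, ← Fintype.sum_of_injective _ hinj _ _ (fun σ hσ => by simp [hv0 σ hσ])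
      fun _ => rfl]
    refine sum_congr rfl fun g _ => ?_
    rw [map_mul, map_intCast, mul_apply_eq_comp]
    rcases Int.units_eq_one_or (Equiv.Perm.sign g) with h | h <;> simp [sgn, h, hv]
  -- Discarding the coordinates that are not permutations leaves |ι|! ‖det(M) h‖² ≤ |ι|! ‖h‖².
  have hle : ∑ e : Equiv.Perm ι, ‖legsAct π M univ v e‖ ^ 2 ≤
      ∑ τ, ‖legsAct π M univ v τ‖ ^ 2 := by
    refine (sum_map univ ⟨_, hinj⟩ fun τ => ‖legsAct π M univ v τ‖ ^ 2).symm.trans_le ?_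
    exact sum_le_univ_sum_of_nonneg fun _ => by positivity
  have hfin := hle.trans ((sum_norm_sq_legsAct_le hM univ v).trans_eq hsum)
  simp only [hact, norm_smul, hsgn, one_mul, sum_const, card_univ, nsmul_eq_mul] at hfin
  exact le_of_sq_le_sq (le_of_mul_le_mul_left hfin (by positivity)) (norm_nonneg _)

end CommutingEntries

/-! ### The resolvent series, the transfer function, and the conclusions. -/

section Resolvent

open MvPowerSeries Finset
open Matrix hiding blockDiag blockDiag_map

variable {d : ℕ}

/-- Multiplication by a variable shifts the monomials of total degree m injectively into those of
degree m + 1; all other coefficients there vanish. -/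
theorem sum_norm_sq_coeff_X_mul (φ : MvPowerSeries (Fin d) ℂ) (i : Fin d) (m : ℕ) :
    ∑ k ∈ finsuppAntidiag univ (m + 1), ‖coeff k (X i * φ)‖ ^ 2 =
      ∑ k ∈ finsuppAntidiag univ m, ‖coeff k φ‖ ^ 2 := by
  symm
  have hinj : Function.Injective fun k : Fin d →₀ ℕ => Finsupp.single i 1 + k :=
    add_right_injective _
  have h1 : ∀ k, coeff (Finsupp.single i 1 + k) (X i * φ) = coeff k φ := fun k => by
    rw [X, coeff_add_monomial_mul, one_mul]
  calc ∑ k ∈ finsuppAntidiag univ m, ‖coeff k φ‖ ^ 2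
      = ∑ k ∈ (finsuppAntidiag univ m).map ⟨_, hinj⟩, ‖coeff k (X i * φ)‖ ^ 2 := by
        rw [sum_map]
        exact sum_congr rfl fun k _ => by rw [Function.Embedding.coeFn_mk, h1]
    _ = _ := by
        refine sum_subset (fun k hk => ?_) fun k hk hk' => ?_
        · obtain ⟨l, hl, rfl⟩ := mem_map.1 hk
          rw [mem_finsuppAntidiag] at hl ⊢
          refine ⟨?_, subset_univ _⟩
          have := hl.1
          simp only [Function.Embedding.coeFn_mk, Finsupp.coe_add, Pi.add_apply, sum_add_distrib,
            this]
          rw [add_comm]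
          simp [Finsupp.single_apply]
        · rw [X, coeff_monomial_mul, if_neg, norm_zero, zero_pow two_ne_zero]
          intro hle
          refine hk' (mem_map.2 ⟨k - Finsupp.single i 1, ?_, add_tsub_cancel_of_le hle⟩)
          rw [mem_finsuppAntidiag] at hk ⊢
          refine ⟨?_, subset_univ _⟩
          have := hk.1
          rw [← add_tsub_cancel_of_le hle] at this
          simp only [Finsupp.coe_add, Pi.add_apply, sum_add_distrib] at this
          simp only [Finsupp.single_apply, sum_ite_eq, mem_univ, if_true] at this
          change ∑ x, (k - Finsupp.single i 1 : Fin d →₀ ℕ) x = m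
          omega

variable {n : Fin d → ℕ} {K : Matrix (Σ i, Fin (n i)) (Σ i, Fin (n i)) ℂ}

theorem exists_formal_resolvent (n : Fin d → ℕ) (K : Matrix (Σ i, Fin (n i)) (Σ i, Fin (n i)) ℂ) :
    ∃ R : Matrix (Σ i, Fin (n i)) (Σ i, Fin (n i)) (MvPowerSeries (Fin d) ℂ),
      R = 1 + K.map C * (blockDiag n X * R) := by
  have hu : IsUnit (1 - K.map C * blockDiag n X : Matrix _ _ (MvPowerSeries (Fin d) ℂ)).det := by
    rw [isUnit_iff_constantCoeff, RingHom.map_det, RingHom.mapMatrix_apply,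
      Matrix.map_sub _ (map_sub _), Matrix.map_mul, map_blockDiag,
      Matrix.map_one _ (map_zero _) (map_one _)]
    have : (blockDiag n fun i => constantCoeff (X i : MvPowerSeries (Fin d) ℂ)) = 0 := by
      simp [blockDiag]
    rw [this, mul_zero, sub_zero, det_one]
    exact isUnit_one
  refine ⟨(1 - K.map C * blockDiag n X)⁻¹, ?_⟩
  have h := Matrix.mul_nonsing_inv _ hu
  rw [sub_mul, one_mul, sub_eq_iff_eq_add, mul_assoc] at h
  exact h

/-- In R = 1 + KZR, multiplication by Z preserves the ℓ² norm of a column while raising the degree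
by one, and K does not increase it. Hence every homogeneous part of a column has norm at most that
of the degree-zero part, a standard basis vector. -/
theorem IsContraction.norm_coeff_resolvent_le (hK : IsContraction K)
    {R : Matrix (Σ i, Fin (n i)) (Σ i, Fin (n i)) (MvPowerSeries (Fin d) ℂ)}
    (hR : R = 1 + K.map C * (blockDiag n X * R)) (k : Fin d →₀ ℕ) (a b : Σ i, Fin (n i)) :
    ‖coeff k (R a b)‖ ≤ 1 := by
  have hentry : ∀ a, R a b = (1 : Matrix _ _ (MvPowerSeries (Fin d) ℂ)) a b +
      ∑ c, C (K a c) * (X c.1 * R c b) := fun a => by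
    conv_lhs => rw [hR]
    rw [Matrix.add_apply, Matrix.mul_apply]
    simp only [Matrix.map_apply, blockDiag, diagonal_mul]
  have hbound : ∀ m, ∑ k ∈ finsuppAntidiag univ m, ∑ a, ‖coeff k (R a b)‖ ^ 2 ≤ 1 := fun m => by
    induction m with
    | zero =>
      have h0 : ∀ a, coeff 0 (R a b) = (1 : Matrix _ _ ℂ) a b := fun a => by
        rw [hentry, map_add, map_sum, Matrix.one_apply, Matrix.one_apply]
        simp only [coeff_C_mul, coeff_zero_X_mul, mul_zero, sum_const_zero, add_zero]
        split_ifs <;> simp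
      rw [finsuppAntidiag_zero, sum_singleton]
      simp only [h0, Matrix.one_apply]
      simp [apply_ite norm]
    | succ m ih =>
      refine le_trans ?_ ih
      calc ∑ k ∈ finsuppAntidiag univ (m + 1), ∑ a, ‖coeff k (R a b)‖ ^ 2
          ≤ ∑ k ∈ finsuppAntidiag univ (m + 1), ∑ c, ‖coeff k (X c.1 * R c b)‖ ^ 2 := by
            refine sum_le_sum fun k hk => ?_
            refine le_trans (le_of_eq ?_)
              (hK.sum_norm_sq_mulVec_le fun c => coeff k (X c.1 * R c b))
            refine sum_congr rfl fun a _ => ?_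
            have hk0 : k ≠ 0 := by
              rintro rfl
              simpa using (mem_finsuppAntidiag.1 hk).1
            rw [hentry, map_add, map_sum, Matrix.one_apply]
            simp only [coeff_C_mul, Matrix.mulVec, dotProduct]
            split_ifs <;> simp [coeff_one, hk0]
        _ = ∑ k ∈ finsuppAntidiag univ m, ∑ a, ‖coeff k (R a b)‖ ^ 2 := by
            rw [sum_comm]
            simp only [sum_norm_sq_coeff_X_mul]
            rw [sum_comm]
  have h1 : ‖coeff k (R a b)‖ ^ 2 ≤ 1 := by
    refine le_trans ?_ (hbound (∑ i, k i))
    refine le_trans ?_ (single_le_sum (f := fun k => ∑ a, ‖coeff k (R a b)‖ ^ 2)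
      (fun _ _ => by positivity) (mem_finsuppAntidiag.2 ⟨rfl, subset_univ _⟩))
    exact single_le_sum (f := fun a => ‖coeff k (R a b)‖ ^ 2) (fun _ _ => by positivity)
      (mem_univ a)
  exact (sq_le_one_iff₀ (norm_nonneg _)).1 h1

/-- Constants as convergent power series. -/
noncomputable def constSeries (d : ℕ) : ℂ →+* convergentSeries d :=
  (C : ℂ →+* MvPowerSeries (Fin d) ℂ).codRestrict _ C_mem_convergentSeries

/-- Variables as convergent power series. -/
noncomputable def varSeries (i : Fin d) : convergentSeries d := ⟨X i, X_mem_convergentSeries i⟩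

theorem IsContraction.exists_resolvent (hK : IsContraction K) :
    ∃ R : Matrix (Σ i, Fin (n i)) (Σ i, Fin (n i)) (convergentSeries d),
      R = 1 + K.map (constSeries d) * (blockDiag n varSeries * R) := by
  obtain ⟨R, hR⟩ := exists_formal_resolvent n K
  let R' : Matrix (Σ i, Fin (n i)) (Σ i, Fin (n i)) (convergentSeries d) :=
    Matrix.of fun a b => ⟨R a b, mem_convergentSeries_of_norm_coeff_le fun k =>
      hK.norm_coeff_resolvent_le hR k a b⟩
  have hR' : R'.map (convergentSeries d).subtype = R := rfl
  refine ⟨R', ?_⟩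
  have hinj : Function.Injective fun M : Matrix (Σ i, Fin (n i)) (Σ i, Fin (n i))
      (convergentSeries d) => M.map (convergentSeries d).subtype :=
    Matrix.map_injective Subtype.val_injective
  refine hinj ?_
  simp only
  rw [Matrix.map_add _ (map_add _), Matrix.map_mul, Matrix.map_mul, map_blockDiag,
    Matrix.map_one _ (map_zero _) (map_one _), Matrix.map_map, hR']
  exact hR

/-- The power series of the transfer function, in terms of that of the resolvent `R`. -/
noncomputable def transferSeries (K : Matrix (Σ i, Fin (n i)) (Σ i, Fin (n i)) ℂ)
    (R : Matrix (Σ i, Fin (n i)) (Σ i, Fin (n i)) (convergentSeries d)) :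
    Matrix (Σ i, Fin (n i)) (Σ i, Fin (n i)) (convergentSeries d) :=
  (-Kᴴ).map (constSeries d) +
    (defect K).map (constSeries d) * (blockDiag n varSeries * (R * (defect Kᴴ).map (constSeries d)))

section Eval

variable {H : Type u} [NormedAddCommGroup H] [InnerProductSpace ℂ H] [CompleteSpace H]
  {T : Fin d → H →L[ℂ] H} (hc : ∀ i j, Commute (T i) (T j)) (hT : ∀ i, ‖T i‖ < 1)

theorem matrixAct_map_constSeries (A : Matrix (Σ i, Fin (n i)) (Σ i, Fin (n i)) ℂ)
    (v : (Σ i, Fin (n i)) → H) (a : Σ i, Fin (n i)) :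
    matrixAct (evalSeries T hc hT) (A.map (constSeries d)) v a = ∑ b, A a b • v b := by
  refine sum_congr rfl fun b _ => ?_
  have : evalSeries T hc hT (constSeries d (A a b)) = A a b • 1 := evalSeries_C hc hT _
  rw [Matrix.map_apply, this]
  simp

theorem matrixAct_blockDiag_varSeries (v : (Σ i, Fin (n i)) → H) (a : Σ i, Fin (n i)) :
    matrixAct (evalSeries T hc hT) (blockDiag n varSeries) v a = T a.1 (v a) := by
  have : evalSeries T hc hT (varSeries a.1) = T a.1 := evalSeries_X hc hT _
  rw [matrixAct, sum_eq_single a]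
  · rw [blockDiag, diagonal_apply_eq, this]
  · intro b _ hb
    rw [blockDiag, diagonal_apply_ne _ hb.symm, map_zero, _root_.zero_apply]
  · simp

/-- With input v, state x, y = Tx and output F, the Julia matrix sends (v, y) to (x, F), so ‖x‖² +
‖F‖² = ‖v‖² + ‖y‖². Since ‖y‖ ≤ ‖x‖, it follows that ‖F‖ ≤ ‖v‖. -/
theorem IsContraction.sum_norm_sq_transferSeries_le (hK : IsContraction K)
    {R : Matrix (Σ i, Fin (n i)) (Σ i, Fin (n i)) (convergentSeries d)}
    (hR : R = 1 + K.map (constSeries d) * (blockDiag n varSeries * R))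
    (v : (Σ i, Fin (n i)) → H) :
    ∑ a, ‖matrixAct (evalSeries T hc hT) (transferSeries K R) v a‖ ^ 2 ≤ ∑ a, ‖v a‖ ^ 2 := by
  set π := evalSeries T hc hT with hπ
  set w := matrixAct π ((defect Kᴴ).map (constSeries d)) v with hw
  set x := matrixAct π R w with hx
  set y : (Σ i, Fin (n i)) → H := fun a => T a.1 (x a) with hy
  have hZ : matrixAct π (blockDiag n varSeries) x = y :=
    funext fun a => matrixAct_blockDiag_varSeries hc hT x a
  have hx' : ∀ a, x a = ∑ b, defect Kᴴ a b • v b + ∑ b, K a b • y b := fun a => by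
    have : x = w + matrixAct π (K.map (constSeries d)) y := by
      conv_lhs => rw [hx, hR]
      rw [matrixAct_add, matrixAct_one, matrixAct_mul, matrixAct_mul, hZ]
    rw [this, Pi.add_apply, hw, hπ, matrixAct_map_constSeries, matrixAct_map_constSeries]
  have hF : ∀ a, matrixAct π (transferSeries K R) v a =
      ∑ b, (-Kᴴ) a b • v b + ∑ b, defect K a b • y b := fun a => by
    rw [transferSeries, matrixAct_add, matrixAct_mul, matrixAct_mul, matrixAct_mul, ← hw, ← hx, hZ,
      Pi.add_apply, hπ, matrixAct_map_constSeries, matrixAct_map_constSeries]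
  have key := sum_norm_sq_of_conjTranspose_mul_self hK.conjTranspose_juliaMatrix_mul (Sum.elim v y)
  simp only [Fintype.sum_sum_type, juliaMatrix, fromBlocks_apply₁₁, fromBlocks_apply₁₂,
    fromBlocks_apply₂₁, fromBlocks_apply₂₂, Sum.elim_inl, Sum.elim_inr, ← hx', ← hF] at key
  have hle : ∑ a, ‖y a‖ ^ 2 ≤ ∑ a, ‖x a‖ ^ 2 := by
    refine sum_le_sum fun a _ => ?_
    gcongr
    exact ((T a.1).le_of_opNorm_le (hT _).le _).trans_eq (one_mul _)
  linarith

end Eval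

theorem commute_smul_one (z : Fin d → ℂ) (i j : Fin d) :
    Commute (z i • (1 : ℂ →L[ℂ] ℂ)) (z j • 1) :=
  ((Commute.one_left _).smul_left _).smul_right _

theorem operatorPow_smul_one (z : Fin d → ℂ) (k : Fin d → ℕ) :
    operatorPow (fun i => z i • (1 : ℂ →L[ℂ] ℂ)) k = (∏ i, z i ^ k i) • 1 := by
  have : (fun i => (z i • (1 : ℂ →L[ℂ] ℂ)) ^ k i) =
      fun i => algebraMap ℂ (ℂ →L[ℂ] ℂ) (z i ^ k i) := by
    ext i
    simp [Algebra.algebraMap_eq_smul_one, smul_pow]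
  rw [operatorPow, this, ← Function.comp_def (algebraMap ℂ (ℂ →L[ℂ] ℂ)), ← List.map_ofFn,
    ← map_list_prod, List.prod_ofFn, Algebra.algebraMap_eq_smul_one]

theorem IsContraction.hasSum_transferMatrix_det (hK : IsContraction K)
    {R : Matrix (Σ i, Fin (n i)) (Σ i, Fin (n i)) (convergentSeries d)}
    (hR : R = 1 + K.map (constSeries d) * (blockDiag n varSeries * R)) {z : Fin d → ℂ}
    (hz : z ∈ polydisk d) :
    HasSum (fun k : Fin d →₀ ℕ => coeff k (transferSeries K R).det.1 * ∏ i, z i ^ k i)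
      (transferMatrix n K z).det ∧ ‖(transferMatrix n K z).det‖ ≤ 1 := by
  have hT : ∀ i, ‖z i • (1 : ℂ →L[ℂ] ℂ)‖ < 1 := fun i => by
    rw [norm_smul, norm_one, mul_one]
    exact hz i
  have hc := commute_smul_one z
  set π := evalSeries (fun i => z i • (1 : ℂ →L[ℂ] ℂ)) hc hT with hπ
  -- Operators on ℂ are scalars, recovered by applying them to 1; thus a point z of the polydisk is
  -- a tuple of strict contractions and series evaluation becomes ordinary evaluation.
  let ε : (ℂ →L[ℂ] ℂ) →+* ℂ :=
    { toFun := fun A => A 1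
      map_one' := rfl
      map_zero' := rfl
      map_add' := fun _ _ => rfl
      map_mul' := fun A B => by
        rw [mul_apply_eq_comp, ← mul_one (B 1), ← smul_eq_mul, map_smul, smul_eq_mul, smul_eq_mul,
          mul_one, mul_comm] }
  have hε : ∀ A, ε A = A 1 := fun _ => rfl
  have hconst : ∀ A : Matrix (Σ i, Fin (n i)) (Σ i, Fin (n i)) ℂ,
      (A.map (constSeries d)).map (ε.comp π) = A := fun A => by
    ext a b
    have : π (constSeries d (A a b)) = A a b • 1 := evalSeries_C hc hT _
    simp [this, hε]
  have hvar : (blockDiag n varSeries).map (ε.comp π) = blockDiag n z := by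
    rw [map_blockDiag]
    congr 1
    ext i
    have : π (varSeries i) = z i • 1 := evalSeries_X hc hT _
    simp [this, hε]
  have hRz : R.map (ε.comp π) = (1 - K * blockDiag n z)⁻¹ := by
    refine (Matrix.inv_eq_right_inv ?_).symm
    have := congrArg (fun M => M.map (ε.comp π)) hR
    simp only [Matrix.map_add _ (map_add _), Matrix.map_mul, hconst, hvar,
      Matrix.map_one _ (map_zero (ε.comp π)) (map_one _)] at this
    rw [sub_mul, one_mul, sub_eq_iff_eq_add, mul_assoc]
    exact this
  have hdet : ε (π (transferSeries K R).det) = (transferMatrix n K z).det := by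
    rw [← RingHom.comp_apply, RingHom.map_det, RingHom.mapMatrix_apply, transferSeries,
      transferMatrix_eq, Matrix.map_add _ (map_add _), Matrix.map_mul, Matrix.map_mul,
      Matrix.map_mul, hconst, hconst, hconst, hvar, hRz]
    simp only [mul_assoc]
  rw [← hdet]
  constructor
  · have h := (hasSum_evalSeries hc hT (transferSeries K R).det).mapL
      (ContinuousLinearMap.apply ℂ ℂ (1 : ℂ))
    simpa [operatorPow_smul_one, hε] using h
  · have h1 := norm_det_le_one_of_contractive
      (hK.sum_norm_sq_transferSeries_le (H := ℂ) hc hT hR)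
    exact ((π _).le_of_opNorm_le h1 1).trans_eq (by simp)

theorem analyticOnNhd_reflectionQuotient {p : MvPolynomial (Fin d) ℂ} (hp : IsSemiStable p) :
    AnalyticOnNhd ℂ (reflectionQuotient n p) (polydisk d) :=
  ((AnalyticOnNhd.eval_mvPolynomial _).mono (Set.subset_univ _)).div
    ((AnalyticOnNhd.eval_mvPolynomial _).mono (Set.subset_univ _)) hp

theorem HasSum.comp_equivFunOnFinite_symm {E : Type*} [AddCommMonoid E] [TopologicalSpace E]
    {f : (Fin d →₀ ℕ) → E} {a : E} (h : HasSum f a) :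
    HasSum (fun k : Fin d → ℕ => f (Finsupp.equivFunOnFinite.symm k)) a :=
  Finsupp.equivFunOnFinite.symm.hasSum_iff.2 h

theorem IsContraction.isSchurAgler (hK : IsContraction K) :
    IsSchurAgler.{u} (reflectionQuotient n (detRep n K)) := by
  obtain ⟨R, hR⟩ := hK.exists_resolvent
  refine ⟨analyticOnNhd_reflectionQuotient hK.isSemiStable,
    fun k => coeff (Finsupp.equivFunOnFinite.symm k) (transferSeries K R).det.1, fun z hz => ?_, fun H _ _ _ T hc hT => ?_⟩
  · rw [hK.reflectionQuotient_eq_det (hK.isSemiStable z hz)]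
    exact (hK.hasSum_transferMatrix_det hR hz).1.comp_equivFunOnFinite_symm
  · refine ⟨evalSeries T hc hT (transferSeries K R).det, ?_,
      norm_det_le_one_of_contractive (hK.sum_norm_sq_transferSeries_le hc hT hR)⟩
    have h := (hasSum_evalSeries hc hT (transferSeries K R).det).comp_equivFunOnFinite_symm
    simp only [Finsupp.coe_equivFunOnFinite_symm] at h
    exact h

theorem IsContraction.isRationalInner (hK : IsContraction K) :
    IsRationalInner (reflectionQuotient n (detRep n K)) := by
  have hs := hK.isSemiStable
  refine ⟨⟨_, _, fun z hz => ⟨hs z hz, rfl⟩⟩, analyticOnNhd_reflectionQuotient hs,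
    fun z hz => ?_, ?_⟩
  · obtain ⟨R, hR⟩ := hK.exists_resolvent
    rw [hK.reflectionQuotient_eq_det (hs z hz)]
    exact (hK.hasSum_transferMatrix_det hR hz).2
  · filter_upwards [ae_torus_eval_ne_zero (detRep n K) (hs 0 fun i => by simp)] with θ hθ
    refine ⟨_, norm_reflectionQuotient_eq_one (multiDegree_detRep_le n K)
      (fun i => Complex.norm_exp_ofReal_mul_I _) hθ, ?_⟩
    have hcont : ContinuousAt (reflectionQuotient n (detRep n K))
        fun i => Complex.exp (θ i * Complex.I) :=
      (MvPolynomial.continuous_eval _).continuousAt.div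
        (MvPolynomial.continuous_eval _).continuousAt hθ
    have hpath : Continuous fun r : ℝ => fun i => (r : ℂ) * Complex.exp (θ i * Complex.I) := by
      fun_prop
    refine hcont.tendsto.comp ((Filter.Tendsto.mono_left ?_ nhdsWithin_le_nhds))
    simpa using hpath.tendsto 1

end Resolvent

theorem mainTheorem2 {d : ℕ} (n : Fin d → ℕ) (p : MvPolynomial (Fin d) ℂ)
    (K : Matrix (Σ i, Fin (n i)) (Σ i, Fin (n i)) ℂ)
    (hK : IsContraction K) (hp : p = detRep n K) :
    (∀ z : Fin d → ℂ, MvPolynomial.eval z p ≠ 0 →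
      reflectionQuotient n p z = (transferMatrix n K z).det) ∧
    IsRationalInner (reflectionQuotient n p) ∧
    IsEventualAglerDenominator.{u} n p ∧
    (multiDegree p = n → IsAglerDenominator.{u} p) := by
  subst hp
  refine ⟨fun z hz => hK.reflectionQuotient_eq_det hz, hK.isRationalInner,
    ⟨hK.isSemiStable, multiDegree_detRep_le n K, hK.isSchurAgler⟩,
    fun h => ⟨hK.isSemiStable, ?_⟩⟩
  rw [h]
  exact hK.isSchurAgler
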